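/- For $q\in(0,\infty)$ and $r\in(0,4]$ let $\phi_q(x)=\frac{1-q^x}{1-q}$ if $q\neq 1$, $\phi_1(x)=x$, let $f_r(x)=rx(1-x)$, and let $\Phi_{q,r}=\phi_q\circ f_r:[0,1]\to[0,1]$ be the $q$-deformed logistic map. A fixed point $x_0\in[0,1]$ of a map $f:[0,1]\to[0,1]$ is called locally asymptotically stable (LAS) if (a) for every $\varepsilon>0$ there is a neighbourhood $V$ of $x_0$ in $[0,1]$ such that $|f^n(x)-x_0|<\varepsilon$ for all $x\in V$ and all $n\ge 1$, and (b) there is a neighbourhood $V$ of $x_0$ in $[0,1]$ such that $\lim_{n\to\infty}f^n(x)=x_0$ for all $x\in V$. It is called globally asymptotically stable (GAS) if it is LAS and $\lim_{n\to\infty}f^n(x)=x_0$ for all $x\in(0,1)$. **Theorem.** Let $q\in(0,\infty)$ and $r\in(0,4]$. Then the following statements hold. 1. If the fixed point $0$ of $\Phi_{q,r}$ is LAS, then it is GAS if and only if $\Phi_{q,r}(x)<x$ for all $x\in(0,1)$. 2. If $x_0\neq 0$ is a LAS fixed point of $\Phi_{q,r}$ in $[0,1]$, then $x_0$ is GAS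 if and only if $0$ is not LAS. -/

import Mathlib

/-- The `q`-deformation `φ_q(x) = (1 - q^x) / (1 - q)`, with its limit, the identity, at `q = 1`. -/
noncomputable def qDeformation (q x : ℝ) : ℝ :=
  if q = 1 then x else (1 - q ^ x) / (1 - q)

/-- The logistic map `f_r(x) = r x (1 - x)`. -/
def logisticMap (r x : ℝ) : ℝ := r * x * (1 - x)

/-- The `q`-deformed logistic map `Φ_{q,r} = φ_q ∘ f_r`. -/
noncomputable def qLogistic (q r : ℝ) : ℝ → ℝ := qDeformation q ∘ logisticMap r

theorem qDeformation_mapsTo {q : ℝ} (hq : 0 < q) :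
    Set.MapsTo (qDeformation q) (Set.Icc 0 1) (Set.Icc 0 1) := by
  rintro x ⟨h0, h1⟩
  unfold qDeformation
  split_ifs with h
  · exact ⟨h0, h1⟩
  · rcases lt_or_gt_of_ne h with h | h
    · have a := Real.rpow_le_one hq.le h.le h0
      have b := Real.rpow_le_rpow_of_exponent_ge hq h.le h1
      rw [Real.rpow_one] at b
      exact ⟨div_nonneg (by linarith) (by linarith),
        (div_le_one (by linarith)).2 (by linarith)⟩
    · have a := Real.one_le_rpow h.le h0
      have b := Real.rpow_le_rpow_of_exponent_le h.le h1
      rw [Real.rpow_one] at b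
      exact ⟨div_nonneg_of_nonpos (by linarith) (by linarith),
        (div_le_one_of_neg (by linarith)).2 (by linarith)⟩

theorem logisticMap_mapsTo {r : ℝ} (hr : r ∈ Set.Ioc (0 : ℝ) 4) :
    Set.MapsTo (logisticMap r) (Set.Icc 0 1) (Set.Icc 0 1) := by
  rintro x ⟨h0, h1⟩
  have a : 0 ≤ x * (1 - x) := mul_nonneg h0 (by linarith)
  unfold logisticMap
  constructor
  · nlinarith [mul_nonneg hr.1.le a]
  · nlinarith [mul_le_mul_of_nonneg_right hr.2 a, sq_nonneg (2 * x - 1)]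

/-- `Φ_{q,r}` is a self-map of `I = [0,1]` for all admissible parameters. -/
theorem qLogistic_mapsTo {q r : ℝ} (hq : 0 < q) (hr : r ∈ Set.Ioc (0 : ℝ) 4) :
    Set.MapsTo (qLogistic q r) (Set.Icc 0 1) (Set.Icc 0 1) :=
  (qDeformation_mapsTo hq).comp (logisticMap_mapsTo hr)

/- The following notions concern a map `f` of `I = [0,1]` into itself and a fixed point `x₀ ∈ I`
of `f`; neighbourhoods are neighbourhoods in `I`. -/

/-- Local stability of the fixed point `x₀` of `f : I → I`. -/
def IsLocallyStable (f : ℝ → ℝ) (x₀ : ℝ) : Prop :=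
  ∀ ε > 0, ∃ V ∈ nhdsWithin x₀ (Set.Icc (0 : ℝ) 1),
    ∀ x ∈ V ∩ Set.Icc (0 : ℝ) 1, ∀ n : ℕ, 1 ≤ n → |f^[n] x - x₀| < ε

/-- The fixed point `x₀` of `f : I → I` attracts a neighbourhood of itself in `I`. -/
def IsAttracting (f : ℝ → ℝ) (x₀ : ℝ) : Prop :=
  ∃ V ∈ nhdsWithin x₀ (Set.Icc (0 : ℝ) 1),
    ∀ x ∈ V ∩ Set.Icc (0 : ℝ) 1,
      Filter.Tendsto (fun n : ℕ => f^[n] x) Filter.atTop (nhds x₀)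

/-- The fixed point `x₀` of `f : I → I` is locally asymptotically stable. -/
def IsLAS (f : ℝ → ℝ) (x₀ : ℝ) : Prop :=
  IsLocallyStable f x₀ ∧ IsAttracting f x₀

/-- The fixed point `x₀` of `f : I → I` is globally asymptotically stable: it is locally
asymptotically stable and attracts every point of the open interval `(0,1)`. -/
def IsGAS (f : ℝ → ℝ) (x₀ : ℝ) : Prop :=
  IsLAS f x₀ ∧ ∀ x ∈ Set.Ioo (0 : ℝ) 1,
    Filter.Tendsto (fun n : ℕ => f^[n] x) Filter.atTop (nhds x₀)

open Filter Topology Set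

/-! ### Monotone orbits of continuous maps -/

/-! The substantial claim is that a LAS fixed point `p ≠ 0` attracts all of `(0,1)` once `0` is not
LAS. Two facts carry it.

Graph against diagonal: if the inverse of `φ_q` is written `x ψ(x)`, then `Φ(x) - x` has on `(0,1]`
the sign of `r (1 - x) - ψ(x)`, which is concave because `ψ` is convex. When `0` is not LAS this
function is nonnegative at points arbitrarily close to `0`. Since `p` attracts, it is an isolated
fixed point, so the graph lies above the diagonal before `p` and below it after
(`qLogistic_sign_of_not_isLAS_zero`). If `p ≤ 1/2`, orbits from `(0,1/2]` are then monotone.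

Second iterate: if `p > 1/2`, stability gives `|Φ'(p)| ≤ 1`. A cross-ratio inequality, playing the
role of a negative Schwarzian derivative, then yields `a < Φ²(a)` on `[1/2,p)`
(`lt_qLogistic_qLogistic`), which forces convergence to `p`. The symmetry `Φ(1 - x) = Φ(x)` covers
the right half of the interval. -/

theorem exists_fixedPt_of_monotone_orbit {f : ℝ → ℝ} (hf : Continuous f) {a b x : ℝ}
    (hab : ∀ n, f^[n] x ∈ Icc a b) (hmono : ∀ n, f^[n] x ≤ f^[n + 1] x) :
    ∃ l ∈ Icc a b, f l = l ∧ x ≤ l ∧ Tendsto (fun n => f^[n] x) atTop (𝓝 l) := by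
  have hm : Monotone fun n => f^[n] x := monotone_nat_of_le_succ hmono
  have ht := tendsto_atTop_ciSup hm ⟨b, by rintro _ ⟨n, rfl⟩; exact (hab n).2⟩
  exact ⟨_, isClosed_Icc.mem_of_tendsto ht (Eventually.of_forall hab),
    isFixedPt_of_tendsto_iterate ht hf.continuousAt, hm.ge_of_tendsto ht 0, ht⟩

theorem exists_fixedPt_of_antitone_orbit {f : ℝ → ℝ} (hf : Continuous f) {a b x : ℝ}
    (hab : ∀ n, f^[n] x ∈ Icc a b) (hmono : ∀ n, f^[n + 1] x ≤ f^[n] x) :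
    ∃ l ∈ Icc a b, f l = l ∧ l ≤ x ∧ Tendsto (fun n => f^[n] x) atTop (𝓝 l) := by
  have hm : Antitone fun n => f^[n] x := antitone_nat_of_succ_le hmono
  have ht := tendsto_atTop_ciInf hm ⟨a, by rintro _ ⟨n, rfl⟩; exact (hab n).1⟩
  exact ⟨_, isClosed_Icc.mem_of_tendsto ht (Eventually.of_forall hab),
    isFixedPt_of_tendsto_iterate ht hf.continuousAt, hm.le_of_tendsto ht 0, ht⟩

theorem tendsto_iterate_of_lt_map {f : ℝ → ℝ} (hf : Continuous f) {a p x : ℝ}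
    (hmaps : MapsTo f (Icc a p) (Icc a p)) (hlt : ∀ y ∈ Ico a p, y < f y) (hp : f p = p)
    (hx : x ∈ Icc a p) : Tendsto (fun n => f^[n] x) atTop (𝓝 p) := by
  have hab : ∀ n, f^[n] x ∈ Icc a p := fun n => hmaps.iterate n hx
  obtain ⟨l, hl, hfl, -, ht⟩ := exists_fixedPt_of_monotone_orbit hf hab fun n => by
    rw [Function.iterate_succ_apply']
    rcases (hab n).2.lt_or_eq with h | h
    · exact (hlt _ ⟨(hab n).1, h⟩).le
    · rw [h, hp]
  rcases hl.2.lt_or_eq with h | h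
  · exact absurd hfl (hlt l ⟨hl.1, h⟩).ne'
  · rwa [h] at ht

theorem tendsto_iterate_of_map_lt {f : ℝ → ℝ} (hf : Continuous f) {p b x : ℝ}
    (hmaps : MapsTo f (Icc p b) (Icc p b)) (hlt : ∀ y ∈ Ioc p b, f y < y) (hp : f p = p)
    (hx : x ∈ Icc p b) : Tendsto (fun n => f^[n] x) atTop (𝓝 p) := by
  have hab : ∀ n, f^[n] x ∈ Icc p b := fun n => hmaps.iterate n hx
  obtain ⟨l, hl, hfl, -, ht⟩ := exists_fixedPt_of_antitone_orbit hf hab fun n => by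
    rw [Function.iterate_succ_apply']
    rcases (hab n).1.lt_or_eq with h | h
    · exact (hlt _ ⟨h, (hab n).2⟩).le
    · rw [← h, hp]
  rcases hl.1.lt_or_eq with h | h
  · exact absurd hfl (hlt l ⟨h, hl.2⟩).ne
  · rwa [← h] at ht

theorem tendsto_iterate_of_iterate {f : ℝ → ℝ} {p x : ℝ} (k : ℕ)
    (h : Tendsto (fun n => f^[n] (f^[k] x)) atTop (𝓝 p)) :
    Tendsto (fun n => f^[n] x) atTop (𝓝 p) := by
  refine (tendsto_add_atTop_iff_nat k).1 (h.congr fun n => ?_)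
  rw [Function.iterate_add_apply]

theorem tendsto_iterate_of_tendsto_iterate_two {f : ℝ → ℝ} (hf : Continuous f) {p x : ℝ}
    (hp : f p = p) (h : Tendsto (fun n => (f^[2])^[n] x) atTop (𝓝 p)) :
    Tendsto (fun n => f^[n] x) atTop (𝓝 p) := by
  have he : Tendsto (fun n => f^[2 * n] x) atTop (𝓝 p) := by
    simpa only [Function.iterate_mul] using h
  have ho : Tendsto (fun n => f^[2 * n + 1] x) atTop (𝓝 p) := by
    have := (hf.tendsto p).comp he
    rw [hp] at this
    exact this.congr fun n => (Function.iterate_succ_apply' f _ x).symm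
  rw [Metric.tendsto_atTop] at he ho ⊢
  intro ε hε
  obtain ⟨N, hN⟩ := he ε hε
  obtain ⟨M, hM⟩ := ho ε hε
  refine ⟨2 * (N + M) + 1, fun n hn => ?_⟩
  obtain ⟨m, rfl | rfl⟩ := n.even_or_odd'
  · exact hN m (by omega)
  · exact hM m (by omega)

/-! ### Local consequences of stability -/

/-- Otherwise distances to `p` grow by a factor `c > 1` at each step near `p`, and nearby orbits
leave a fixed ball. -/
theorem abs_deriv_le_one_of_isLocallyStable {f : ℝ → ℝ} {p d : ℝ} (hp : p ∈ Ioo (0 : ℝ) 1)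
    (hfp : f p = p) (hd : HasDerivAt f d p) (hs : IsLocallyStable f p) : |d| ≤ 1 := by
  by_contra! h1
  obtain ⟨c, hc1, hcd⟩ := exists_between h1
  have hexp : ∀ᶠ x in 𝓝 p, c * |x - p| ≤ |f x - p| := by
    have hlit := hd.isLittleO.def (sub_pos.2 hcd)
    filter_upwards [hlit] with x hx
    rw [hfp, Real.norm_eq_abs, Real.norm_eq_abs, smul_eq_mul] at hx
    have h2 : |(x - p) * d| - |f x - p| ≤ |(x - p) * d - (f x - p)| := abs_sub_abs_le_abs_sub _ _
    rw [abs_sub_comm _ (f x - p), abs_mul] at h2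
    linarith
  obtain ⟨ε, hε, hball⟩ := Metric.eventually_nhds_iff.1 hexp
  obtain ⟨V, hV, hVs⟩ := hs ε hε
  have hV' : V ∈ 𝓝 p := by rwa [nhdsWithin_eq_nhds.2 (Icc_mem_nhds hp.1 hp.2)] at hV
  have hmem : V ∩ Icc 0 1 ∩ Metric.ball p ε ∈ 𝓝 p :=
    inter_mem (inter_mem hV' (Icc_mem_nhds hp.1 hp.2)) (Metric.ball_mem_nhds p hε)
  obtain ⟨x, ⟨hxV, hxε⟩, hxp⟩ :=
    Filter.nonempty_of_mem (inter_mem (mem_nhdsWithin_of_mem_nhds hmem)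
      (self_mem_nhdsWithin : {p}ᶜ ∈ 𝓝[≠] p))
  have hlt : ∀ n, |f^[n] x - p| < ε := by
    rintro (_ | n)
    · exact hxε
    · exact hVs x hxV _ (by omega)
  have hgrow : ∀ n, c ^ n * |x - p| ≤ |f^[n] x - p| := by
    intro n
    induction n with
    | zero => simp
    | succ n ih =>
      rw [Function.iterate_succ_apply', pow_succ']
      have := hball (hlt n : dist _ _ < ε)
      nlinarith
  have hpos : 0 < |x - p| := abs_pos.2 (sub_ne_zero.2 hxp)
  obtain ⟨n, hn⟩ := pow_unbounded_of_one_lt (ε / |x - p|) hc1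
  rw [div_lt_iff₀ hpos] at hn
  linarith [hlt n, hgrow n]

theorem IsAttracting.eventually_eq_of_fixedPt {f : ℝ → ℝ} {p : ℝ} (hp : p ∈ Ioo (0 : ℝ) 1)
    (ha : IsAttracting f p) : ∃ δ > 0, ∀ x, |x - p| < δ → f x = x → x = p := by
  obtain ⟨V, hV, hVt⟩ := ha
  have hV' : V ∈ 𝓝 p := by rwa [nhdsWithin_eq_nhds.2 (Icc_mem_nhds hp.1 hp.2)] at hV
  obtain ⟨δ, hδ, hball⟩ := Metric.mem_nhds_iff.1 (inter_mem hV' (Icc_mem_nhds hp.1 hp.2))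
  refine ⟨δ, hδ, fun x hx hfx => ?_⟩
  have ht := hVt x (hball hx)
  simp only [Function.iterate_fixed hfx] at ht
  exact tendsto_nhds_unique tendsto_const_nhds ht

theorem isLAS_zero_of_map_lt {f : ℝ → ℝ} (hf : Continuous f) (hf0 : f 0 = 0)
    (hmaps : MapsTo f (Icc 0 1) (Icc 0 1)) {δ : ℝ} (hδ : 0 < δ) (hδ1 : δ ≤ 1)
    (hlt : ∀ x ∈ Ioo 0 δ, f x < x) : IsLAS f 0 := by
  have hself : ∀ x ∈ Ico 0 δ, MapsTo f (Icc 0 x) (Icc 0 x) := by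
    rintro x hx y ⟨h0, hy⟩
    refine ⟨(hmaps ⟨h0, by linarith [hx.2]⟩).1, ?_⟩
    rcases h0.lt_or_eq with h | h
    · exact (hlt y ⟨h, hy.trans_lt hx.2⟩).le.trans hy
    · rw [← h, hf0]; exact hx.1
  constructor
  · intro ε hε
    refine ⟨_, mem_nhdsWithin_of_mem_nhds (Iio_mem_nhds (lt_min hδ hε)), ?_⟩
    rintro x ⟨hx, h0, -⟩ n -
    have hx' := lt_min_iff.1 (mem_Iio.1 hx)
    have := (hself x ⟨h0, hx'.1⟩).iterate n ⟨h0, le_rfl⟩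
    rw [sub_zero, abs_of_nonneg this.1]
    exact this.2.trans_lt hx'.2
  · refine ⟨_, mem_nhdsWithin_of_mem_nhds (Iio_mem_nhds hδ), ?_⟩
    rintro x ⟨hx, h0, -⟩
    exact tendsto_iterate_of_map_lt hf (hself x ⟨h0, hx⟩)
      (fun y hy => hlt y ⟨hy.1, hy.2.trans_lt hx⟩) hf0 ⟨h0, le_rfl⟩

/-! ### The `q`-deformation -/

theorem qDeformation_one (x : ℝ) : qDeformation 1 x = x := if_pos rfl

theorem qDeformation_of_ne {q : ℝ} (h : q ≠ 1) (x : ℝ) :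
    qDeformation q x = (1 - q ^ x) / (1 - q) := if_neg h

theorem qDeformation_zero (q : ℝ) : qDeformation q 0 = 0 := by
  simp [qDeformation]

theorem hasDerivAt_qDeformation {q : ℝ} (hq : 0 < q) (hq1 : q ≠ 1) (x : ℝ) :
    HasDerivAt (qDeformation q) (q ^ x * Real.log q / (q - 1)) x := by
  have h := ((hasDerivAt_id x).const_rpow hq).const_sub 1 |>.div_const (1 - q)
  have he : qDeformation q = fun x => (1 - q ^ x) / (1 - q) := funext (qDeformation_of_ne hq1)
  rw [he]
  refine h.congr_deriv ?_
  rw [← neg_sub 1 q, div_neg, ← neg_div]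
  simp [mul_comm]

theorem log_div_sub_one_pos {q : ℝ} (hq : 0 < q) (hq1 : q ≠ 1) : 0 < Real.log q / (q - 1) := by
  rcases lt_or_gt_of_ne hq1 with h | h
  · exact div_pos_of_neg_of_neg (Real.log_neg hq h) (by linarith)
  · exact div_pos (Real.log_pos h) (by linarith)

theorem continuous_qDeformation {q : ℝ} (hq : 0 < q) : Continuous (qDeformation q) := by
  by_cases h : q = 1
  · subst h; exact continuous_id.congr fun x => (qDeformation_one x).symm
  · exact continuous_iff_continuousAt.2 fun x => (hasDerivAt_qDeformation hq h x).continuousAt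

theorem strictMono_qDeformation {q : ℝ} (hq : 0 < q) : StrictMono (qDeformation q) := by
  by_cases h : q = 1
  · subst h; exact fun x y hxy => by simpa only [qDeformation_one] using hxy
  · refine strictMono_of_deriv_pos fun x => ?_
    rw [(hasDerivAt_qDeformation hq h x).deriv, mul_div_assoc]
    exact mul_pos (Real.rpow_pos_of_pos hq x) (log_div_sub_one_pos hq h)

/-- Clearing denominators compares `(2 + t) e⁻ᵗ + t` with its value `2` at `0`; this function is
increasing because `1 + t ≤ eᵗ`. -/
theorem one_add_half_le_div_one_sub_exp_neg {t : ℝ} (ht : t ≠ 0) :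
    1 + t / 2 ≤ t / (1 - Real.exp (-t)) := by
  have hmono : Monotone fun t : ℝ => (2 + t) * Real.exp (-t) + t := by
    have hder : ∀ t : ℝ, HasDerivAt (fun t : ℝ => (2 + t) * Real.exp (-t) + t)
        (1 * Real.exp (-t) + (2 + t) * (Real.exp (-t) * -1) + 1) t := fun t =>
      (((hasDerivAt_id t).const_add 2).mul (hasDerivAt_neg t).exp).add (hasDerivAt_id t)
    refine monotone_of_deriv_nonneg (fun t => (hder t).differentiableAt) fun t => ?_
    rw [(hder t).deriv]
    have h1 : Real.exp t * Real.exp (-t) = 1 := by rw [← Real.exp_add]; simp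
    nlinarith [mul_le_mul_of_nonneg_right (Real.add_one_le_exp t) (Real.exp_pos (-t)).le]
  rcases lt_or_gt_of_ne ht with h | h
  · have h1 := hmono h.le
    have h2 : 1 < Real.exp (-t) := Real.one_lt_exp_iff.2 (by linarith)
    simp only [neg_zero, Real.exp_zero] at h1
    rw [le_div_iff_of_neg (by linarith)]
    linarith
  · have h1 := hmono h.le
    have h2 : Real.exp (-t) < 1 := by simpa using h
    simp only [neg_zero, Real.exp_zero] at h1
    rw [le_div_iff₀ (by linarith)]
    linarith

/-- The infinitesimal cross-ratio inequality for the `q`-deformation. -/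
theorem exists_hasDerivAt_qDeformation_crossRatio {q : ℝ} (hq : 0 < q) (v : ℝ) :
    ∃ D > 0, HasDerivAt (qDeformation q) D v ∧ ∀ u w, u < v → v < w →
      1 / (v - u) + 1 / (w - v) ≤ D / (qDeformation q v - qDeformation q u) +
        D / (qDeformation q w - qDeformation q v) := by
  by_cases hq1 : q = 1
  · subst hq1
    refine ⟨1, one_pos, ?_, fun u w _ _ => by simp only [qDeformation_one]; rfl⟩
    exact (hasDerivAt_id v).congr_of_eventuallyEq (Eventually.of_forall qDeformation_one)
  have hL : Real.log q ≠ 0 := Real.log_ne_zero_of_pos_of_ne_one hq hq1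
  have hs : q - 1 ≠ 0 := sub_ne_zero.2 hq1
  refine ⟨_, ?_, hasDerivAt_qDeformation hq hq1 v, fun u w hu hw => ?_⟩
  · rw [mul_div_assoc]
    exact mul_pos (Real.rpow_pos_of_pos hq v) (log_div_sub_one_pos hq hq1)
  have key : ∀ z, z ≠ v → q ^ v * Real.log q / (q - 1) / (qDeformation q v - qDeformation q z) =
      Real.log q / (1 - Real.exp (-(Real.log q * (v - z)))) := by
    intro z hz
    have hvz : Real.exp (-(Real.log q * (v - z))) = q ^ z / q ^ v := by
      rw [← Real.rpow_sub hq, Real.rpow_def_of_pos hq]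
      congr 1; ring
    have hpos := Real.rpow_pos_of_pos hq v
    have hne : q ^ v - q ^ z ≠ 0 := by
      rw [sub_ne_zero]
      intro h
      exact hz (Real.rpow_right_inj hq hq1 |>.1 h.symm)
    have hd : qDeformation q v - qDeformation q z = (q ^ v - q ^ z) / (q - 1) := by
      rw [qDeformation_of_ne hq1, qDeformation_of_ne hq1, ← neg_sub q 1]
      field_simp
      ring
    have he : 1 - q ^ z / q ^ v = (q ^ v - q ^ z) / q ^ v := by
      field_simp
    rw [hvz, hd, he]
    field_simp
  -- Dividing by `|v - z|` gives the linear term `log q / 2` opposite signs at `z = u` and `z = w`,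
  -- so it cancels in the sum.
  have bound : ∀ z, z ≠ v → (1 + Real.log q * (v - z) / 2) / |v - z| ≤
      Real.log q / (1 - Real.exp (-(Real.log q * (v - z)))) * ((v - z) / |v - z|) := by
    intro z hz
    have h := div_le_div_of_nonneg_right (one_add_half_le_div_one_sub_exp_neg
      (mul_ne_zero hL (sub_ne_zero.2 hz.symm))) (abs_nonneg (v - z))
    refine h.trans_eq ?_
    rw [mul_div_right_comm, mul_div_assoc]
  have h1 := bound u hu.ne
  have h2 := bound w hw.ne'
  have hA : v - u ≠ 0 := (sub_pos.2 hu).ne'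
  have hB : v - w ≠ 0 := (sub_neg.2 hw).ne
  have e1 : (1 + Real.log q * (v - u) / 2) / (v - u) = 1 / (v - u) + Real.log q / 2 := by
    field_simp
  have e2 : (1 + Real.log q * (v - w) / 2) / -(v - w) = 1 / -(v - w) - Real.log q / 2 := by
    field_simp
    ring
  rw [← key u hu.ne, abs_of_pos (sub_pos.2 hu), div_self hA, mul_one, e1] at h1
  rw [← key w hw.ne', abs_of_neg (sub_neg.2 hw), div_neg_self hB, mul_neg_one, ← div_neg, e2,
    neg_sub, neg_sub] at h2
  linarith

theorem exists_convexOn_mul_rightInverse_qDeformation {q : ℝ} (hq : 0 < q) :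
    ∃ ψ : ℝ → ℝ, ConvexOn ℝ (Icc 0 1) ψ ∧ ∀ x ∈ Icc (0 : ℝ) 1, qDeformation q (x * ψ x) = x := by
  by_cases hq1 : q = 1
  · subst hq1
    exact ⟨fun _ => 1, convexOn_const 1 (convex_Icc 0 1), fun x _ => by simp [qDeformation_one]⟩
  have hL : Real.log q ≠ 0 := Real.log_ne_zero_of_pos_of_ne_one hq hq1
  have hs : q - 1 ≠ 0 := sub_ne_zero.2 hq1
  set c := (q - 1) / Real.log q with hc
  have hc0 : 0 < c := by
    rw [hc, ← inv_div]; exact inv_pos.2 (log_div_sub_one_pos hq hq1)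
  have hpos : ∀ y ∈ Icc (0 : ℝ) 1, 0 < 1 + (q - 1) * y := by
    rintro y ⟨h0, h1⟩
    rcases h0.lt_or_eq with h | h
    · nlinarith [mul_pos hq h]
    · rw [← h]; norm_num
  have hpos' : ∀ x ∈ Icc (0 : ℝ) 1, ∀ t ∈ Icc (0 : ℝ) 1, 0 < 1 + (q - 1) * x * t := by
    intro x hx t ht
    rw [mul_assoc]
    exact hpos _ ⟨mul_nonneg hx.1 ht.1, mul_le_one₀ hx.2 ht.1 ht.2⟩
  have hint : ∀ x ∈ Icc (0 : ℝ) 1, IntervalIntegrable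
      (fun t : ℝ => c * (1 + (q - 1) * x * t)⁻¹) MeasureTheory.volume 0 1 := by
    intro x hx
    refine ContinuousOn.intervalIntegrable ?_
    rw [uIcc_of_le zero_le_one]
    exact continuousOn_const.mul ((by fun_prop : Continuous fun t : ℝ =>
      1 + (q - 1) * x * t).continuousOn.inv₀ fun t ht => (hpos' x hx t ht).ne')
  -- For `x ≠ 0` this is `log (1 + (q - 1) x) / (x log q)`. The integral form includes `x = 0` and
  -- is an average of reciprocals of affine functions of `x`, hence convex.
  refine ⟨fun x => ∫ t in (0 : ℝ)..1, c * (1 + (q - 1) * x * t)⁻¹, ⟨convex_Icc 0 1, ?_⟩, ?_⟩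
  · intro x hx y hy a b ha hb hab
    simp only [smul_eq_mul]
    rw [← intervalIntegral.integral_const_mul, ← intervalIntegral.integral_const_mul,
      ← intervalIntegral.integral_add ((hint x hx).const_mul a) ((hint y hy).const_mul b)]
    refine intervalIntegral.integral_mono_on zero_le_one
      (hint _ (convex_Icc 0 1 hx hy ha hb hab))
      (((hint x hx).const_mul a).add ((hint y hy).const_mul b)) fun t ht => ?_
    have h := (convexOn_zpow (𝕜 := ℝ) (-1)).2 (hpos' x hx t ht) (hpos' y hy t ht) ha hb hab
    simp only [zpow_neg_one, smul_eq_mul] at h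
    have he : a * (1 + (q - 1) * x * t) + b * (1 + (q - 1) * y * t) =
        1 + (q - 1) * (a * x + b * y) * t := by
      linear_combination hab
    rw [he] at h
    nlinarith [mul_le_mul_of_nonneg_left h hc0.le]
  · intro x hx
    have hftc : ∫ t in (0 : ℝ)..1, x * (c * (1 + (q - 1) * x * t)⁻¹) =
        Real.log (1 + (q - 1) * x * 1) / Real.log q -
          Real.log (1 + (q - 1) * x * 0) / Real.log q := by
      refine intervalIntegral.integral_eq_sub_of_hasDerivAt (f := fun t =>
        Real.log (1 + (q - 1) * x * t) / Real.log q) (fun t ht => ?_) ((hint x hx).const_mul x)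
      rw [uIcc_of_le zero_le_one] at ht
      have h := ((((hasDerivAt_id t).const_mul ((q - 1) * x)).const_add 1).log
        (hpos' x hx t ht).ne').div_const (Real.log q)
      refine h.congr_deriv ?_
      have := (hpos' x hx t ht).ne'
      simp only [hc, id]
      field_simp
    rw [intervalIntegral.integral_const_mul] at hftc
    have hx1 := hpos x hx
    have hexp : q ^ (Real.log (1 + (q - 1) * x) / Real.log q) = 1 + (q - 1) * x := by
      rw [Real.rpow_def_of_pos hq, mul_div_cancel₀ _ hL, Real.exp_log hx1]
    rw [hftc, mul_one, mul_zero, add_zero, Real.log_one, zero_div, sub_zero,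
      qDeformation_of_ne hq1, hexp]
    have : 1 - q ≠ 0 := by rwa [← neg_sub, neg_ne_zero]
    field_simp
    ring

/-! ### The `q`-deformed logistic map -/

theorem qLogistic_apply (q r x : ℝ) : qLogistic q r x = qDeformation q (logisticMap r x) := rfl

theorem logisticMap_one_sub (r x : ℝ) : logisticMap r (1 - x) = logisticMap r x := by
  unfold logisticMap; ring

theorem qLogistic_one_sub (q r x : ℝ) : qLogistic q r (1 - x) = qLogistic q r x := by
  rw [qLogistic_apply, logisticMap_one_sub, qLogistic_apply]

theorem qLogistic_zero (q r : ℝ) : qLogistic q r 0 = 0 := by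
  simp [qLogistic_apply, logisticMap, qDeformation_zero]

theorem qLogistic_one (q r : ℝ) : qLogistic q r 1 = 0 := by
  simp [qLogistic_apply, logisticMap, qDeformation_zero]

theorem continuous_qLogistic {q : ℝ} (hq : 0 < q) (r : ℝ) : Continuous (qLogistic q r) :=
  (continuous_qDeformation hq).comp (by unfold logisticMap; fun_prop)

theorem qLogistic_strictMonoOn {q r : ℝ} (hq : 0 < q) (hr : 0 < r) :
    StrictMonoOn (qLogistic q r) (Iic (1 / 2)) := by
  intro x hx y hy hxy
  refine strictMono_qDeformation hq ?_
  have h : 0 < (y - x) * (1 - x - y) :=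
    mul_pos (by linarith) (by linarith [mem_Iic.1 hx, mem_Iic.1 hy])
  unfold logisticMap
  nlinarith [mul_pos hr h]

theorem qLogistic_strictAntiOn {q r : ℝ} (hq : 0 < q) (hr : 0 < r) :
    StrictAntiOn (qLogistic q r) (Ici (1 / 2)) := by
  intro x hx y hy hxy
  rw [← qLogistic_one_sub q r x, ← qLogistic_one_sub q r y]
  rw [mem_Ici] at hx hy
  exact qLogistic_strictMonoOn hq hr (mem_Iic.2 (by linarith)) (mem_Iic.2 (by linarith))
    (by linarith)

theorem qLogistic_le_half {q r : ℝ} (hq : 0 < q) (hr : 0 < r) (x : ℝ) :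
    qLogistic q r x ≤ qLogistic q r (1 / 2) := by
  rcases le_total x (1 / 2) with h | h
  · exact (qLogistic_strictMonoOn hq hr).monotoneOn h self_mem_Iic h
  · exact (qLogistic_strictAntiOn hq hr).antitoneOn self_mem_Ici h h

/-! ### Cross-ratios and the second iterate -/

/-- The two sides differ by exactly `1 / (p + a - 1) - 1 / (p + b - 1)`, the source of strictness.
-/
theorem logisticMap_crossRatio_lt {r a p b : ℝ} (hr : 0 < r) (ha : 1 / 2 ≤ a) (hap : a < p)
    (hpb : p < b) : 1 / (p - a) + 1 / (b - p) <
      r * (2 * p - 1) * (1 / (logisticMap r p - logisticMap r b) +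
        1 / (logisticMap r a - logisticMap r p)) := by
  have h1 : logisticMap r p - logisticMap r b = r * (b - p) * (p + b - 1) := by
    unfold logisticMap; ring
  have h2 : logisticMap r a - logisticMap r p = r * (p - a) * (p + a - 1) := by
    unfold logisticMap; ring
  have hA : 0 < p - a := by linarith
  have hB : 0 < b - p := by linarith
  have hU : 0 < p + b - 1 := by linarith
  have hV : 0 < p + a - 1 := by linarith
  have h3 : r * (2 * p - 1) * (1 / (r * (b - p) * (p + b - 1)) + 1 / (r * (p - a) * (p + a - 1))) -
      (1 / (p - a) + 1 / (b - p)) = 1 / (p + a - 1) - 1 / (p + b - 1) := by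
    field_simp
    ring
  have h4 : 1 / (p + b - 1) < 1 / (p + a - 1) := one_div_lt_one_div_of_lt hV (by linarith)
  rw [h1, h2]
  linarith

/-- The infinitesimal cross-ratio inequality for the decreasing branch of `Φ_{q,r}`. -/
theorem exists_hasDerivAt_qLogistic_crossRatio {q r p : ℝ} (hq : 0 < q) (hr : 0 < r) :
    ∃ D, HasDerivAt (qLogistic q r) D p ∧ ∀ a b, 1 / 2 ≤ a → a < p → p < b →
      1 / (p - a) + 1 / (b - p) < |D| * (1 / (qLogistic q r p - qLogistic q r b) +
        1 / (qLogistic q r a - qLogistic q r p)) := by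
  obtain ⟨D, hD, hder, hcr⟩ := exists_hasDerivAt_qDeformation_crossRatio hq (logisticMap r p)
  have hf : HasDerivAt (logisticMap r) (r * (1 - 2 * p)) p := by
    have h := ((hasDerivAt_id p).const_mul r).mul ((hasDerivAt_id p).const_sub 1)
    refine h.congr_deriv ?_
    simp only [id]; ring
  refine ⟨_, hder.comp p hf, fun a b ha hap hpb => ?_⟩
  have habs : |D * (r * (1 - 2 * p))| = r * (2 * p - 1) * D := by
    rw [abs_of_neg (mul_neg_of_pos_of_neg hD (mul_neg_of_pos_of_neg hr (by linarith)))]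
    ring
  have hfb : logisticMap r b < logisticMap r p := by
    unfold logisticMap; nlinarith [mul_pos hr (mul_pos (sub_pos.2 hpb) (by linarith : 0 < p + b - 1))]
  have hfa : logisticMap r p < logisticMap r a := by
    unfold logisticMap; nlinarith [mul_pos hr (mul_pos (sub_pos.2 hap) (by linarith : 0 < p + a - 1))]
  have h := mul_le_mul_of_nonneg_left (hcr _ _ hfb hfa)
    (mul_pos hr (by linarith : 0 < 2 * p - 1)).le
  refine (logisticMap_crossRatio_lt hr ha hap hpb).trans_le (h.trans_eq ?_)
  simp only [habs, qLogistic_apply]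
  ring

/-- With `b = Φ(a)` and `c = Φ(b)`, both sides of the cross-ratio inequality contain `1 / (b - p)`.
Since `|D| ≤ 1`, cancelling it leaves `1 / (p - a) < 1 / (p - c)`. -/
theorem lt_qLogistic_qLogistic {q r p a : ℝ} (hq : 0 < q) (hr : 0 < r) (hp : p ∈ Ioo (1 / 2 : ℝ) 1)
    (hfp : qLogistic q r p = p) (hs : IsLocallyStable (qLogistic q r) p) (ha : 1 / 2 ≤ a)
    (hap : a < p) : a < qLogistic q r (qLogistic q r a) := by
  obtain ⟨D, hD, hcr⟩ := exists_hasDerivAt_qLogistic_crossRatio (p := p) hq hr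
  have hD1 := abs_deriv_le_one_of_isLocallyStable ⟨by linarith [hp.1], hp.2⟩ hfp hD hs
  have hanti := qLogistic_strictAntiOn hq hr
  have hb : p < qLogistic q r a := by
    conv_lhs => rw [← hfp]
    exact hanti (mem_Ici.2 ha) (mem_Ici.2 hp.1.le) hap
  have hc : qLogistic q r (qLogistic q r a) < p := by
    conv_rhs => rw [← hfp]
    exact hanti (mem_Ici.2 hp.1.le) (mem_Ici.2 (hp.1.trans hb).le) hb
  have h := hcr a _ ha hap hb
  rw [hfp] at h
  set b := qLogistic q r a
  set c := qLogistic q r b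
  have hpos : 0 ≤ 1 / (p - c) + 1 / (b - p) :=
    add_nonneg (one_div_pos.2 (by linarith)).le (one_div_pos.2 (by linarith)).le
  have h2 := h.trans_le (mul_le_of_le_one_left hpos hD1)
  have h3 := lt_of_one_div_lt_one_div (by linarith) (lt_of_add_lt_add_right h2)
  linarith

/-- `Φ²` pushes `[1/2,p]` up towards `p`, and `Φ` sends `[p,Φ(1/2)]` into `[1/2,p]`. An orbit
starting further left increases until it passes `1/2`, as there is no fixed point in `(0,1/2]`. -/
theorem tendsto_iterate_qLogistic_of_half_lt {q r p : ℝ} (hq : 0 < q) (hr : 0 < r)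
    (hp : p ∈ Ioo (1 / 2 : ℝ) 1) (hfp : qLogistic q r p = p)
    (hs : IsLocallyStable (qLogistic q r) p) (hlt : ∀ x ∈ Ioo 0 p, x < qLogistic q r x)
    {x : ℝ} (hx : x ∈ Ioc (0 : ℝ) (1 / 2)) :
    Tendsto (fun n => (qLogistic q r)^[n] x) atTop (𝓝 p) := by
  have hcont := continuous_qLogistic hq r
  have hanti := (qLogistic_strictAntiOn hq hr).antitoneOn
  have hg : ∀ a ∈ Ico (1 / 2) p, a < qLogistic q r (qLogistic q r a) := fun a ha =>
    lt_qLogistic_qLogistic hq hr hp hfp hs ha.1 ha.2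
  have hge : ∀ a ∈ Icc (1 / 2) p, p ≤ qLogistic q r a := fun a ha => by
    conv_lhs => rw [← hfp]
    exact hanti (mem_Ici.2 ha.1) (mem_Ici.2 hp.1.le) ha.2
  have hle : ∀ a, p ≤ a → qLogistic q r a ≤ p := fun a ha => by
    conv_rhs => rw [← hfp]
    exact hanti (mem_Ici.2 hp.1.le) (mem_Ici.2 (hp.1.le.trans ha)) ha
  have hleft : ∀ a ∈ Icc (1 / 2) p, Tendsto (fun n => (qLogistic q r)^[n] a) atTop (𝓝 p) := by
    intro a ha
    refine tendsto_iterate_of_tendsto_iterate_two hcont hfp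
      (tendsto_iterate_of_lt_map (hcont.iterate 2) (a := 1 / 2) ?_ hg ?_ ha)
    · intro y hy
      refine ⟨?_, hle _ (hge y hy)⟩
      rcases hy.2.lt_or_eq with h | h
      · exact hy.1.trans (hg y ⟨hy.1, h⟩).le
      · simp only [h, Function.iterate_fixed hfp, hp.1.le]
    · exact Function.iterate_fixed hfp 2
  have hright : ∀ a ∈ Icc (1 / 2) (qLogistic q r (1 / 2)),
      Tendsto (fun n => (qLogistic q r)^[n] a) atTop (𝓝 p) := by
    intro a ha
    rcases le_total a p with h | h
    · exact hleft a ⟨ha.1, h⟩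
    · refine tendsto_iterate_of_iterate 1 (hleft _ ⟨?_, hle a h⟩)
      -- `1/2 < Φ²(1/2) ≤ Φ(a)`, because `a ≤ Φ(1/2)` and `Φ` decreases there.
      exact (hg (1 / 2) ⟨le_rfl, hp.1⟩).le.trans
        (hanti (mem_Ici.2 ha.1) (mem_Ici.2 (ha.1.trans ha.2)) ha.2)
  have hesc : ∃ n, 1 / 2 ≤ (qLogistic q r)^[n] x := by
    by_contra! hn
    have hpos : ∀ n, 0 < (qLogistic q r)^[n] x := by
      intro n
      induction n with
      | zero => exact hx.1
      | succ n ih =>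
        rw [Function.iterate_succ_apply']
        exact ih.trans (hlt _ ⟨ih, (hn n).trans hp.1⟩)
    obtain ⟨l, hl, hfl, hxl, -⟩ := exists_fixedPt_of_monotone_orbit hcont
      (fun n => ⟨(hpos n).le, (hn n).le⟩) fun n => by
        rw [Function.iterate_succ_apply']
        exact (hlt _ ⟨hpos n, (hn n).trans hp.1⟩).le
    exact (hlt l ⟨hx.1.trans_le hxl, hl.2.trans_lt hp.1⟩).ne' hfl
  obtain ⟨n, hn⟩ := hesc
  refine tendsto_iterate_of_iterate n (hright _ ⟨hn, ?_⟩)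
  cases n with
  | zero => exact hx.2.trans (hlt _ ⟨by norm_num, hp.1⟩).le
  | succ n =>
    rw [Function.iterate_succ_apply']
    exact qLogistic_le_half hq hr _

theorem tendsto_iterate_qLogistic_of_le_half {q r p : ℝ} (hq : 0 < q) (hr : 0 < r)
    (hp : p ≤ 1 / 2) (hfp : qLogistic q r p = p) (hlt : ∀ x ∈ Ioo 0 p, x < qLogistic q r x)
    (hgt : ∀ x ∈ Ioo p 1, qLogistic q r x < x) {x : ℝ} (hx : x ∈ Ioc (0 : ℝ) (1 / 2)) :
    Tendsto (fun n => (qLogistic q r)^[n] x) atTop (𝓝 p) := by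
  have hcont := continuous_qLogistic hq r
  have hmono := (qLogistic_strictMonoOn hq hr).monotoneOn
  rcases le_total x p with h | h
  · refine tendsto_iterate_of_lt_map hcont (a := x) (fun y hy => ⟨?_, ?_⟩)
      (fun y hy => hlt y ⟨hx.1.trans_le hy.1, hy.2⟩) hfp ⟨le_rfl, h⟩
    · rcases hy.2.lt_or_eq with h' | h'
      · exact hy.1.trans (hlt y ⟨hx.1.trans_le hy.1, h'⟩).le
      · rwa [h', hfp]
    · conv_rhs => rw [← hfp]
      exact hmono (mem_Iic.2 (hy.2.trans hp)) (mem_Iic.2 hp) hy.2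
  · refine tendsto_iterate_of_map_lt hcont (b := x) (fun y hy => ⟨?_, ?_⟩)
      (fun y hy => hgt y ⟨hy.1, by linarith [hy.2, hx.2]⟩) hfp ⟨h, le_rfl⟩
    · conv_lhs => rw [← hfp]
      exact hmono (mem_Iic.2 hp) (mem_Iic.2 (hy.2.trans hx.2)) hy.1
    · rcases hy.1.lt_or_eq with h' | h'
      · exact (hgt y ⟨h', by linarith [hy.2, hx.2]⟩).le.trans hy.2
      · rwa [← h', hfp]

/-! ### The position of the graph relative to the diagonal -/

/-- Applying the inverse of `φ_q` turns `x < Φ(x)` into `x ψ(x) < r x (1 - x)`; then divide by `x`.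
-/
theorem exists_concaveOn_sign_qLogistic {q : ℝ} (hq : 0 < q) (r : ℝ) :
    ∃ k : ℝ → ℝ, ConcaveOn ℝ (Icc 0 1) k ∧ ∀ x ∈ Ioc (0 : ℝ) 1,
      (x < qLogistic q r x ↔ 0 < k x) ∧ (qLogistic q r x < x ↔ k x < 0) := by
  obtain ⟨ψ, hψ, hinv⟩ := exists_convexOn_mul_rightInverse_qDeformation hq
  have hlin : ConcaveOn ℝ (Icc (0 : ℝ) 1) fun x => r * (1 - x) :=
    ⟨convex_Icc 0 1, fun x _ y _ a b _ _ hab => by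
      simp only [smul_eq_mul]; apply le_of_eq; linear_combination r * hab⟩
  refine ⟨fun x => r * (1 - x) - ψ x, hlin.sub hψ, fun x hx => ?_⟩
  have h := hinv x ⟨hx.1.le, hx.2⟩
  have he : logisticMap r x = x * (r * (1 - x)) := by unfold logisticMap; ring
  constructor
  · conv_lhs => lhs; rw [← h]
    rw [qLogistic_apply, (strictMono_qDeformation hq).lt_iff_lt, he,
      mul_lt_mul_iff_right₀ hx.1, sub_pos]
  · conv_lhs => rhs; rw [← h]
    rw [qLogistic_apply, (strictMono_qDeformation hq).lt_iff_lt, he,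
      mul_lt_mul_iff_right₀ hx.1, sub_neg]

theorem qLogistic_sign_of_not_isLAS_zero {q r p : ℝ} (hq : 0 < q) (hr : r ∈ Ioc (0 : ℝ) 4)
    (hp : p ∈ Ioo (0 : ℝ) 1) (hfp : qLogistic q r p = p) (ha : IsAttracting (qLogistic q r) p)
    (h0 : ¬ IsLAS (qLogistic q r) 0) :
    (∀ x ∈ Ioo 0 p, x < qLogistic q r x) ∧ ∀ x ∈ Ioo p 1, qLogistic q r x < x := by
  obtain ⟨k, hk, hsign⟩ := exists_concaveOn_sign_qLogistic hq r
  obtain ⟨δ, hδ, hiso⟩ := ha.eventually_eq_of_fixedPt hp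
  have hfix : ∀ x ∈ Ioc (0 : ℝ) 1, k x = 0 ↔ qLogistic q r x = x := by
    intro x hx
    obtain ⟨h1, h2⟩ := hsign x hx
    constructor
    · intro h
      exact le_antisymm (not_lt.1 fun h' => (h1.1 h').ne' h) (not_lt.1 fun h' => (h2.1 h').ne h)
    · intro h
      exact le_antisymm (not_lt.1 fun h' => (h1.2 h').ne' h) (not_lt.1 fun h' => (h2.2 h').ne h)
  have hkp : k p = 0 := (hfix p ⟨hp.1, hp.2.le⟩).2 hfp
  -- Otherwise `Φ(x) < x` on all of `(0,y)`, which makes `0` LAS.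
  have hsmall : ∀ y ∈ Ioc (0 : ℝ) 1, ∃ x ∈ Ioo 0 y, 0 ≤ k x := by
    intro y hy
    by_contra! hneg
    exact h0 (isLAS_zero_of_map_lt (continuous_qLogistic hq r) (qLogistic_zero q r)
      (qLogistic_mapsTo hq hr) hy.1 hy.2 fun x hx =>
        (hsign x ⟨hx.1, hx.2.le.trans hy.2⟩).2.2 (hneg x hx))
  have hconc : ∀ x y z, 0 < x → x < y → y < z → z ≤ 1 →
      (z - y) * k x + (y - x) * k z ≤ (z - x) * k y := by
    intro x y z hx hxy hyz hz
    have hxz : 0 < z - x := by linarith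
    have h := hk.2 (x := x) (y := z) ⟨hx.le, by linarith⟩ ⟨by linarith, hz⟩
      (div_pos (sub_pos.2 hyz) hxz).le (div_pos (sub_pos.2 hxy) hxz).le (by field_simp; ring)
    have he : (z - y) / (z - x) * x + (y - x) / (z - x) * z = y := by field_simp; ring
    simp only [smul_eq_mul] at h
    rw [he] at h
    have h' := mul_le_mul_of_nonneg_left h hxz.le
    refine le_of_eq_of_le ?_ h'
    field_simp
  -- once a value is positive or a zero lies to the right, earlier values are nonnegative
  have hnn : ∀ y z, 0 < y → y < z → z ≤ 1 → 0 ≤ k z → 0 ≤ k y ∧ (0 < k z → 0 < k y) := by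
    intro y z hy hyz hz hkz
    obtain ⟨x, hx, hkx⟩ := hsmall y ⟨hy, by linarith⟩
    have h := hconc x y z hx.1 hx.2 hyz hz
    have h1 : 0 < z - y := by linarith
    have h2 : 0 < y - x := by linarith [hx.2]
    have h3 : 0 < z - x := by linarith
    have h4 := mul_nonneg h1.le hkx
    refine ⟨?_, fun hpos => ?_⟩
    · exact nonneg_of_mul_nonneg_right (by nlinarith [mul_nonneg h2.le hkz]) h3
    · exact (mul_pos_iff_of_pos_left h3).1 (by nlinarith [mul_pos h2 hpos])
  constructor
  · intro x hx
    have hx1 : x ∈ Ioc (0 : ℝ) 1 := ⟨hx.1, (hx.2.trans hp.2).le⟩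
    rw [(hsign x hx1).1]
    by_contra! hkx
    -- If `k x ≤ 0`, concavity forces `k` to vanish between `x` and `p`; a zero within `δ` of `p`
    -- contradicts isolation.
    have hmax : max x (p - δ / 2) < p := max_lt hx.2 (by linarith)
    obtain ⟨y, hy1, hy2⟩ := exists_between hmax
    have hy := max_lt_iff.1 hy1
    have hky : k y = 0 := le_antisymm
      (not_lt.1 fun h => ((hnn x y hx.1 hy.1 (hy2.trans hp.2).le h.le).2 h).not_ge hkx)
      (hnn y p (hx.1.trans hy.1) hy2 hp.2.le hkp.ge).1
    have hfy := (hfix y ⟨hx.1.trans hy.1, (hy2.trans hp.2).le⟩).1 hky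
    exact hy2.ne (hiso y (by rw [abs_of_neg (by linarith)]; linarith [hy.2]) hfy)
  · intro x hx
    have hx1 : x ∈ Ioc (0 : ℝ) 1 := ⟨hp.1.trans hx.1, hx.2.le⟩
    rw [(hsign x hx1).2]
    by_contra! hkx
    have hmin : p < min x (p + δ / 2) := lt_min hx.1 (by linarith)
    obtain ⟨y, hy1, hy2⟩ := exists_between hmin
    have hy := lt_min_iff.1 hy2
    have hy1' : y ≤ 1 := (hy.1.trans hx.2).le
    have hky : k y = 0 := le_antisymm
      (not_lt.1 fun h => ((hnn p y hp.1 hy1 hy1' h.le).2 h).ne' hkp)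
      (hnn y x (hp.1.trans hy1) hy.1 hx.2.le hkx).1
    have hfy := (hfix y ⟨hp.1.trans hy1, hy1'⟩).1 hky
    exact hy1.ne' (hiso y (by rw [abs_of_pos (by linarith)]; linarith [hy.2]) hfy)

/-! ### The main theorem -/

theorem mainTheorem2 (q r : ℝ) (hq : 0 < q) (hr : r ∈ Set.Ioc (0 : ℝ) 4) :
    (IsLAS (qLogistic q r) 0 →
      (IsGAS (qLogistic q r) 0 ↔ ∀ x ∈ Set.Ioo (0 : ℝ) 1, qLogistic q r x < x)) ∧
    (∀ p ∈ Set.Icc (0 : ℝ) 1, p ≠ 0 → Function.IsFixedPt (qLogistic q r) p →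
      IsLAS (qLogistic q r) p →
      (IsGAS (qLogistic q r) p ↔ ¬ IsLAS (qLogistic q r) 0)) := by
  have hcont := continuous_qLogistic hq r
  have hmaps := qLogistic_mapsTo hq hr
  have hnofix : ∀ {p x : ℝ}, x ≠ p → qLogistic q r x = x →
      ¬ Tendsto (fun n => (qLogistic q r)^[n] x) atTop (𝓝 p) := by
    intro p x hxp hfx ht
    simp only [Function.iterate_fixed hfx] at ht
    exact hxp (tendsto_nhds_unique tendsto_const_nhds ht)
  refine ⟨fun hlas => ⟨fun hgas x hx => ?_, fun hlt => ⟨hlas, fun x hx => ?_⟩⟩,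
    fun p hp hp0 hfp hlas => ⟨fun hgas h0 => ?_, fun h0 => ⟨hlas, fun x hx => ?_⟩⟩⟩
  · by_contra! hle
    -- As `Φ(1) = 0 < 1`, the graph must recross the diagonal, giving a fixed point in `(0,1)` that
    -- `0` cannot attract.
    obtain ⟨y, hy, hfy⟩ : ∃ y ∈ Icc x 1, y - qLogistic q r y = 0 :=
      intermediate_value_Icc hx.2.le (continuous_id.sub hcont).continuousOn
        ⟨by simpa using hle, by simp [qLogistic_one]⟩
    have hy1 : y ≠ 1 := by
      rintro rfl
      simp [qLogistic_one] at hfy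
    have hy0 : 0 < y := hx.1.trans_le hy.1
    exact hnofix hy0.ne' (sub_eq_zero.1 hfy).symm (hgas.2 y ⟨hy0, hy.2.lt_of_ne hy1⟩)
  · have hlt' : ∀ y ∈ Ioc 0 x, qLogistic q r y < y := fun y hy =>
      hlt y ⟨hy.1, hy.2.trans_lt hx.2⟩
    refine tendsto_iterate_of_map_lt hcont (b := x) (fun y hy => ?_) hlt' (qLogistic_zero q r)
      ⟨hx.1.le, le_rfl⟩
    refine ⟨(hmaps ⟨hy.1, hy.2.trans hx.2.le⟩).1, ?_⟩
    rcases hy.1.lt_or_eq with h | h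
    · exact (hlt' y ⟨h, hy.2⟩).le.trans hy.2
    · rw [← h, qLogistic_zero]; exact hx.1.le
  · obtain ⟨V, hV, hVt⟩ := h0.2
    obtain ⟨x, hxV, hx⟩ : (V ∩ Ioo 0 1).Nonempty := by
      have h1 : V ∈ 𝓝[>] (0 : ℝ) := by
        rw [← nhdsWithin_Ioo_eq_nhdsGT (zero_lt_one' ℝ)]
        exact nhdsWithin_mono 0 Ioo_subset_Icc_self hV
      exact Filter.nonempty_of_mem (inter_mem h1 (Ioo_mem_nhdsGT zero_lt_one))
    exact hp0 (tendsto_nhds_unique (hgas.2 x hx) (hVt x ⟨hxV, Ioo_subset_Icc_self hx⟩))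
  · have hp1 : p ≠ 1 := by
      rintro rfl
      exact one_ne_zero (hfp.symm.trans (qLogistic_one q r))
    have hp' : p ∈ Ioo (0 : ℝ) 1 := ⟨hp.1.lt_of_ne' hp0, hp.2.lt_of_ne hp1⟩
    obtain ⟨hlt, hgt⟩ := qLogistic_sign_of_not_isLAS_zero hq hr hp' hfp hlas.2 h0
    have hhalf : ∀ y ∈ Ioc (0 : ℝ) (1 / 2),
        Tendsto (fun n => (qLogistic q r)^[n] y) atTop (𝓝 p) := by
      intro y hy
      rcases le_or_gt p (1 / 2) with h | h
      · exact tendsto_iterate_qLogistic_of_le_half hq hr.1 h hfp hlt hgt hy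
      · exact tendsto_iterate_qLogistic_of_half_lt hq hr.1 ⟨h, hp'.2⟩ hfp hlas.1 hlt hy
    rcases le_total x (1 / 2) with h | h
    · exact hhalf x ⟨hx.1, h⟩
    · have ht := hhalf (1 - x) ⟨by linarith [hx.2], by linarith⟩
      rw [← tendsto_add_atTop_iff_nat 1] at ht ⊢
      simpa only [Function.iterate_succ_apply, qLogistic_one_sub] using ht
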